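/- Let $n\ge 4$. The degree partition of a simple graph on $n$ vertices is its degree sequence arranged in weakly decreasing order (zero entries are kept); let $\mathsf{DP}(n)\subset\mathbb{R}^n$ be the convex hull of all degree partitions of simple graphs on $n$ vertices. For integers $k,l\ge 0$ with $1\le k+l\le n$, consider the Fulkerson--Hoffman--McAndrew (FHM) inequality $$\sum_{i=1}^{k} x_i-\sum_{i=n-l+1}^{n} x_i\ \le\ k(n-1-l).\qquad (\ast_{k,l})$$ The inequalities $x_i\ge x_{i+1}$ ($1\le i\le n-1$) and all the inequalities $(\ast_{k,l})$ are valid on $\mathsf{DP}(n)$, and the facets of $\mathsf{DP}(n)$ (its nonempty faces of dimension $\dim\mathsf{DP}(n)-1$) are exactly the sets of points of $\mathsf{DP}(n)$ at which one of the following inequalities holds with equality: (i) $x_i\ge x_{i+1}$, for $i=1,\dots,n-1$; (ii) $(\ast_{k,l})$, where $(k,l)=(1,0)$, or $(k,l)=(0,1)$, or $k,l\neq 0$ and either $2\le k+l\le n-3$ or $k+l=n$. Moreover, among the inequalities $(\ast_{k,l})$ with $1\le k+l\le n$, exactly those listed in (ii) determine facets. Consequently, $\mathsf{DP}(n)$ has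 exactly $\frac{n(n-3)}{2}+6$ facets. -/

import Mathlib

noncomputable section

open Classical in
/-- The degree partitions of simple graphs on `n` vertices, as integer vectors: rearrangements
`i ↦ deg (σ i)` of a degree sequence that are weakly decreasing (zero entries are allowed). -/
def degreePartitions (n : ℕ) : Set (Fin n → ℕ) :=
  {d | Antitone d ∧ ∃ (G : SimpleGraph (Fin n)) (σ : Equiv.Perm (Fin n)),
    ∀ i, d i = G.degree (σ i)}

/-- The polytope of degree partitions: the convex hull in `ℝⁿ` of all degree partitions. -/
def degreePartitionPolytope (n : ℕ) : Set (Fin n → ℝ) :=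
  convexHull ℝ ((fun (d : Fin n → ℕ) (i : Fin n) => (d i : ℝ)) '' degreePartitions n)

/-- The dimension of the affine span of a nonempty set in `ℝⁿ`. -/
def affineDim {n : ℕ} (P : Set (Fin n → ℝ)) : ℕ :=
  Module.finrank ℝ (vectorSpan ℝ P)

/-- `F` is a facet of the polytope `P`: a nonempty face (the set of maximizers over `P` of a linear
functional) whose dimension is one less than that of `P`. -/
def IsFacet {n : ℕ} (P F : Set (Fin n → ℝ)) : Prop :=
  IsExposed ℝ P F ∧ F.Nonempty ∧ affineDim F + 1 = affineDim P

/-- The left side `x₁ + ⋯ + x_k - (x_{n-l+1} + ⋯ + x_n)` of the Fulkerson-Hoffman-McAndrew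
inequality. The coordinates are indexed from `0` here. -/
def fhmLhs (n k l : ℕ) (x : Fin n → ℝ) : ℝ :=
  (∑ i ∈ Finset.univ.filter (fun i : Fin n => (i : ℕ) < k), x i) -
    ∑ i ∈ Finset.univ.filter (fun i : Fin n => n ≤ (i : ℕ) + l), x i

/-- The right side `k (n - 1 - l)` of the Fulkerson-Hoffman-McAndrew inequality. -/
def fhmRhs (n k l : ℕ) : ℝ := (k : ℝ) * ((n : ℝ) - 1 - (l : ℝ))

/-- The pairs `(k, l)` that are listed: `(1, 0)`, `(0, 1)`, and those with `k, l ≠ 0` and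
`k + l ∈ {2, …, n - 3, n}`. -/
def FacetPair (n k l : ℕ) : Prop :=
  (k = 1 ∧ l = 0) ∨ (k = 0 ∧ l = 1) ∨
    (k ≠ 0 ∧ l ≠ 0 ∧ ((2 ≤ k + l ∧ k + l ≤ n - 3) ∨ k + l = n))

end

/-! The polytope `P` is full-dimensional, so a facet is a nonempty exposed face on which the
functionals that are constant form a line. Everything is reduced to computing such functionals.

Completeness. Let a facet be the maximizer set of `c ≠ 0`. Over all degree sequences the maximum of
`c` is the sum over pairs of `max 0 (c u + c v)`, attained by the threshold graph of `c`. If `c` is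
weakly decreasing, this maximum splits as `t` times the maximum of the sign vector `a` of `c` plus
the maximum of `c - t • a`, where `t` is the least nonzero `|c i|`. Hence a maximizer of `c` also
maximizes `a`, which is an FHM functional. If `c` is not weakly decreasing, project it to `d` in the
decreasing cone. The threshold graph of `d` maximizes `d`, and `c - d` is nonnegative on its degree
vector, so every maximizer of `c` in `P` is orthogonal to `c - d`. A nonzero element of the polar
cone vanishes only where two consecutive coordinates agree.

Conversely, the listed equalities give facets because enough explicit graphs lie on them: cliques
and a star for `x i = x j`, and pairs of shifted graphs differing in one edge for the FHM faces. An
unlisted FHM face admits a second, independent constant functional, obtained by comparing with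
neighbouring inequalities. -/

open Matrix

/-! ### Facets and the functionals constant on them -/

/-- The linear functional `x ↦ w ⬝ᵥ x` is constant on `F`. -/
def ConstOn {n : ℕ} (w : Fin n → ℝ) (F : Set (Fin n → ℝ)) : Prop :=
  ∀ x ∈ F, ∀ y ∈ F, w ⬝ᵥ x = w ⬝ᵥ y

theorem mem_dualAnnihilator_vectorSpan_iff {n : ℕ} (w : Fin n → ℝ) (F : Set (Fin n → ℝ)) :
    dotProductEquiv ℝ (Fin n) w ∈ (vectorSpan ℝ F).dualAnnihilator ↔ ConstOn w F := by
  rw [Submodule.mem_dualAnnihilator]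
  constructor
  · intro h x hx y hy
    have := h _ (vsub_mem_vectorSpan ℝ hx hy)
    simp only [dotProductEquiv_apply_apply, vsub_eq_sub, dotProduct_sub] at this
    linarith
  · intro h v hv
    have hle : vectorSpan ℝ F ≤ LinearMap.ker (dotProductEquiv ℝ (Fin n) w) := by
      rw [vectorSpan_def, Submodule.span_le]
      rintro _ ⟨x, hx, y, hy, rfl⟩
      simp [dotProduct_sub, h x hx y hy]
    exact hle hv

theorem affineDim_add_finrank_dualAnnihilator {n : ℕ} (F : Set (Fin n → ℝ)) :
    affineDim F + Module.finrank ℝ (vectorSpan ℝ F).dualAnnihilator = n := by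
  have := Subspace.finrank_add_finrank_dualAnnihilator_eq (vectorSpan ℝ F)
  simpa [affineDim] using this

theorem affineDim_eq_of_constOn_eq_zero {n : ℕ} {P : Set (Fin n → ℝ)}
    (h : ∀ w, ConstOn w P → w = 0) : affineDim P = n := by
  have h0 : (vectorSpan ℝ P).dualAnnihilator = ⊥ := by
    rw [eq_bot_iff]
    intro f hf
    obtain ⟨w, rfl⟩ := (dotProductEquiv ℝ (Fin n)).surjective f
    rw [h w ((mem_dualAnnihilator_vectorSpan_iff w P).1 hf)]
    simp
  have := affineDim_add_finrank_dualAnnihilator P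
  rw [h0] at this
  simpa using this

theorem isFacet_of_constOn {n : ℕ} {P : Set (Fin n → ℝ)} (hP : affineDim P = n)
    {a : Fin n → ℝ} {b : ℝ} (ha : a ≠ 0) (hab : ∀ x ∈ P, a ⬝ᵥ x ≤ b)
    (hne : ∃ x ∈ P, a ⬝ᵥ x = b)
    (hw : ∀ w, ConstOn w {x ∈ P | a ⬝ᵥ x = b} → ∃ r : ℝ, w = r • a) :
    IsFacet P {x ∈ P | a ⬝ᵥ x = b} := by
  obtain ⟨x₀, hx₀, hx₀b⟩ := hne
  refine ⟨fun _ => ⟨LinearMap.toContinuousLinearMap (dotProductEquiv ℝ (Fin n) a), ?_⟩,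
    ⟨x₀, hx₀, hx₀b⟩, ?_⟩
  · ext x
    simp only [Set.mem_ofPred_eq, LinearMap.coe_toContinuousLinearMap', dotProductEquiv_apply_apply]
    refine and_congr_right fun hx => ⟨fun h y hy => h ▸ hab y hy, fun h => ?_⟩
    exact le_antisymm (hab x hx) (hx₀b ▸ h x₀ hx₀)
  · have h1 : (vectorSpan ℝ {x ∈ P | a ⬝ᵥ x = b}).dualAnnihilator
        = Submodule.span ℝ {dotProductEquiv ℝ (Fin n) a} := by
      apply le_antisymm
      · intro f hf
        obtain ⟨w, rfl⟩ := (dotProductEquiv ℝ (Fin n)).surjective f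
        obtain ⟨r, rfl⟩ := hw w ((mem_dualAnnihilator_vectorSpan_iff w _).1 hf)
        rw [map_smul]
        exact Submodule.smul_mem _ _ (Submodule.mem_span_singleton_self _)
      · rw [Submodule.span_singleton_le_iff_mem, mem_dualAnnihilator_vectorSpan_iff]
        intro x hx y hy
        rw [hx.2, hy.2]
    have h2 := affineDim_add_finrank_dualAnnihilator {x ∈ P | a ⬝ᵥ x = b}
    rw [h1, finrank_span_singleton (by simpa using ha)] at h2
    rw [h2, hP]

theorem IsFacet.eq_smul_of_constOn {n : ℕ} {P F : Set (Fin n → ℝ)} (hP : affineDim P = n)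
    (hF : IsFacet P F) {a w : Fin n → ℝ} (ha : a ≠ 0) (haF : ConstOn a F) (hwF : ConstOn w F) :
    ∃ r : ℝ, w = r • a := by
  have h1 := hF.2.2
  have h2 := affineDim_add_finrank_dualAnnihilator F
  have h3 : Module.finrank ℝ (vectorSpan ℝ F).dualAnnihilator = 1 := by omega
  have ha' := (mem_dualAnnihilator_vectorSpan_iff a F).2 haF
  have hw' := (mem_dualAnnihilator_vectorSpan_iff w F).2 hwF
  have h4 := (finrank_eq_one_iff_of_nonzero'
    (⟨_, ha'⟩ : (vectorSpan ℝ F).dualAnnihilator) (by simpa using ha)).1 h3 ⟨_, hw'⟩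
  obtain ⟨r, hr⟩ := h4
  refine ⟨r, (dotProductEquiv ℝ (Fin n)).injective ?_⟩
  rw [map_smul]
  exact (congrArg Subtype.val hr).symm

/-- A facet is the set of maximizers of some nonzero functional. -/
theorem IsFacet.exists_functional {n : ℕ} {P F : Set (Fin n → ℝ)} (hF : IsFacet P F) :
    ∃ c : Fin n → ℝ, c ≠ 0 ∧ F = {x ∈ P | ∀ y ∈ P, c ⬝ᵥ y ≤ c ⬝ᵥ x} := by
  obtain ⟨f, hf⟩ := hF.1 hF.2.1
  refine ⟨(dotProductEquiv ℝ (Fin n)).symm f, ?_, ?_⟩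
  · intro h0
    have hf0 : (f : (Fin n → ℝ) →ₗ[ℝ] ℝ) = 0 := by simpa using h0
    have hFP : F = P := by
      rw [hf]
      ext x
      have : ∀ y, f y = 0 := fun y => LinearMap.congr_fun hf0 y
      simp [this]
    have := hF.2.2
    rw [hFP] at this
    omega
  · have key : ∀ y, (dotProductEquiv ℝ (Fin n)).symm (f : (Fin n → ℝ) →ₗ[ℝ] ℝ) ⬝ᵥ y = f y := by
      intro y
      rw [← dotProductEquiv_apply_apply, LinearEquiv.apply_symm_apply]
      rfl
    simp only [key]
    exact hf

/-- The functional exposing `F` is a multiple of `a`, so it takes the same value on the whole slice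
`a ⬝ᵥ x = b` of `P`, which therefore consists of maximizers. -/
theorem IsFacet.eq_of_subset {n : ℕ} {P F : Set (Fin n → ℝ)} (hP : affineDim P = n)
    (hF : IsFacet P F) {a : Fin n → ℝ} {b : ℝ} (ha : a ≠ 0) (hFa : ∀ x ∈ F, a ⬝ᵥ x = b) :
    F = {x ∈ P | a ⬝ᵥ x = b} := by
  obtain ⟨c, hc, hFc⟩ := hF.exists_functional
  obtain ⟨x₀, hx₀⟩ := hF.2.1
  have haF : ConstOn a F := fun x hx y hy => by rw [hFa x hx, hFa y hy]
  have hcF : ConstOn c F := by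
    intro x hx y hy
    rw [hFc] at hx hy
    exact le_antisymm (hy.2 x hx.1) (hx.2 y hy.1)
  obtain ⟨r, rfl⟩ := hF.eq_smul_of_constOn hP ha haF hcF
  apply Set.Subset.antisymm
  · intro x hx
    refine ⟨?_, hFa x hx⟩
    rw [hFc] at hx
    exact hx.1
  · rintro x ⟨hx, hxb⟩
    have h0 := hFa x₀ hx₀
    rw [hFc] at hx₀ ⊢
    refine ⟨hx, fun y hy => (hx₀.2 y hy).trans_eq ?_⟩
    simp [smul_dotProduct, h0, hxb]

/-! ### The decreasing cone and its polar -/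

/-- The Euclidean projection onto the cone of weakly decreasing vectors. -/
theorem exists_antitone_projection {n : ℕ} (c : Fin n → ℝ) :
    ∃ d : Fin n → ℝ, Antitone d ∧ (c - d) ⬝ᵥ d = 0 ∧ ∀ x, Antitone x → (c - d) ⬝ᵥ x ≤ 0 := by
  let K : Set (EuclideanSpace ℝ (Fin n)) := {x | ∀ i j, i ≤ j → x j ≤ x i}
  have hconv : Convex ℝ K := by
    intro x hx y hy s t hs ht _ i j hij
    simp only [PiLp.add_apply, PiLp.smul_apply, smul_eq_mul]
    have := mul_le_mul_of_nonneg_left (hx i j hij) hs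
    have := mul_le_mul_of_nonneg_left (hy i j hij) ht
    linarith
  have hclosed : IsClosed K := by
    simp only [K, Set.ofPred_forall]
    refine isClosed_iInter fun i => isClosed_iInter fun j => isClosed_iInter fun _ =>
      isClosed_le (by fun_prop) (by fun_prop)
  have hne : K.Nonempty := ⟨0, by simp [K]⟩
  obtain ⟨d, hd, hd'⟩ := exists_norm_eq_iInf_of_complete_convex hne hclosed.isComplete hconv
    (WithLp.toLp 2 c)
  rw [norm_eq_iInf_iff_real_inner_le_zero hconv hd] at hd'
  have hle : ∀ x : Fin n → ℝ, Antitone x → (c - d.ofLp) ⬝ᵥ (x - d.ofLp) ≤ 0 := by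
    intro x hx
    have := hd' (WithLp.toLp 2 x) (fun i j hij => hx hij)
    rw [EuclideanSpace.inner_eq_star_dotProduct] at this
    simpa [dotProduct_comm] using this
  have hdA : Antitone d.ofLp := fun i j hij => hd i j hij
  have h0 : (c - d.ofLp) ⬝ᵥ d.ofLp = 0 := by
    -- Testing the variational inequality at `0` and at `2d` gives orthogonality.
    have h1 := hle 0 (fun i j _ => le_rfl)
    have h2 := hle (d.ofLp + d.ofLp) (fun i j hij => add_le_add (hdA hij) (hdA hij))
    simp only [zero_sub, dotProduct_neg, add_sub_cancel_right] at h1 h2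
    linarith
  refine ⟨d.ofLp, hdA, h0, fun x hx => ?_⟩
  have := hle x hx
  rw [dotProduct_sub, h0] at this
  linarith

/-- A nonzero vector in the polar of the decreasing cone vanishes only on a proper face. -/
theorem exists_eq_of_polar {n : ℕ} {e : Fin n → ℝ} (he : e ≠ 0)
    (hpol : ∀ x, Antitone x → e ⬝ᵥ x ≤ 0) :
    ∃ i j : Fin n, (j : ℕ) = i + 1 ∧ ∀ x, Antitone x → e ⬝ᵥ x = 0 → x i = x j := by
  let s : ℕ → (Fin n → ℝ) := fun p i => if (i : ℕ) < p then 1 else 0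
  have hs : ∀ p, Antitone (s p) := by
    intro p i j hij
    have : (i : ℕ) ≤ j := hij
    simp only [s]
    split_ifs <;> first | omega | norm_num
  have htop : e ⬝ᵥ s n = 0 := by
    have h1 := hpol (-(s n)) (fun i j _ => by simp [s])
    have h2 := hpol _ (hs n)
    rw [dotProduct_neg] at h1
    linarith
  -- Consecutive differences of the `s p` are the standard basis vectors, so `e` cannot vanish on
  -- all of them.
  obtain ⟨p, hp⟩ : ∃ p, e ⬝ᵥ s p < 0 := by
    by_contra! hcon
    have hz : ∀ p, e ⬝ᵥ s p = 0 := fun p => le_antisymm (hpol _ (hs p)) (hcon p)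
    apply he
    ext i
    have h1 : s (i + 1) - s i = Pi.single i 1 := by
      ext j
      simp only [s, Pi.sub_apply, Pi.single_apply, Fin.ext_iff]
      split_ifs <;> first | omega | norm_num
    have h2 : e ⬝ᵥ (s (i + 1) - s i) = 0 := by rw [dotProduct_sub, hz, hz, sub_zero]
    rw [h1, dotProduct_single_one] at h2
    exact h2
  have hp0 : p ≠ 0 := by
    rintro rfl
    simp [s, dotProduct] at hp
  have hpn : p < n := by
    by_contra! hcon
    have : s p = s n := by
      ext i
      simp only [s]
      have := i.2
      rw [if_pos (by omega), if_pos this]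
    rw [this, htop] at hp
    exact lt_irrefl _ hp
  refine ⟨⟨p - 1, by omega⟩, ⟨p, hpn⟩, by simp only; omega, fun x hx hex => ?_⟩
  set i : Fin n := ⟨p - 1, by omega⟩ with hi
  set j : Fin n := ⟨p, hpn⟩ with hj
  have hij : x j ≤ x i := hx (by simp [hi, hj, Fin.le_def])
  -- Closing the gap at `p` keeps `x` decreasing. With `e ⬝ᵥ x = 0` and `e ⬝ᵥ s p < 0`, polarity
  -- forces the gap to be zero.
  have hanti : Antitone (x - (x i - x j) • s p) := by
    intro u v huv
    simp only [Pi.sub_apply, Pi.smul_apply, smul_eq_mul, s]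
    have huv' : (u : ℕ) ≤ v := huv
    have := hx huv
    split_ifs with h1 h2
    · linarith
    · omega
    · have h3 : x i ≤ x u := hx (by simp only [hi, Fin.le_def]; omega)
      have h4 : x v ≤ x j := hx (by simp only [hj, Fin.le_def]; omega)
      linarith
    · linarith
  have h5 := hpol _ hanti
  rw [dotProduct_sub, hex, dotProduct_smul, smul_eq_mul] at h5
  by_contra hne
  have : 0 < x i - x j := sub_pos.2 (lt_of_le_of_ne hij (Ne.symm hne))
  nlinarith

/-! ### Maximizing a functional over degree sequences -/

theorem sum_lt_add_swap {n : ℕ} (g : Fin n → Fin n → ℝ) :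
    (∑ u, ∑ v, if u < v then g u v + g v u else 0) = ∑ u, ∑ v, if u ≠ v then g u v else 0 := by
  have h1 : ∀ u v : Fin n, (if u ≠ v then g u v else 0)
      = (if u < v then g u v else 0) + (if v < u then g u v else 0) := by
    intro u v
    rcases lt_trichotomy u v with h | h | h
    · simp [h, h.ne, h.not_gt]
    · simp [h]
    · simp [h, h.ne', h.not_gt]
  have h2 : ∀ u v : Fin n, (if u < v then g u v + g v u else 0)
      = (if u < v then g u v else 0) + (if u < v then g v u else 0) := by
    intro u v
    split_ifs <;> simp
  simp only [h1, h2, Finset.sum_add_distrib]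
  congr 1
  exact Finset.sum_comm

/-- The maximum of `c ⬝ᵥ d` over all degree sequences `d`. -/
def maxValue {n : ℕ} (c : Fin n → ℝ) : ℝ :=
  ∑ u, ∑ v, if u < v then max 0 (c u + c v) else 0

open Classical in
/-- The degree sequence of a graph as a real vector. -/
noncomputable def degVec {n : ℕ} (G : SimpleGraph (Fin n)) : Fin n → ℝ := fun i => (G.degree i : ℝ)

open Classical in
theorem degVec_apply {n : ℕ} (G : SimpleGraph (Fin n)) (i : Fin n) :
    degVec G i = ∑ j, if G.Adj i j then 1 else 0 := by
  rw [Finset.sum_boole, degVec, ← SimpleGraph.card_neighborFinset_eq_degree,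
    SimpleGraph.neighborFinset_eq_filter]

open Classical in
theorem dotProduct_degVec {n : ℕ} (c : Fin n → ℝ) (G : SimpleGraph (Fin n)) :
    c ⬝ᵥ degVec G = ∑ u, ∑ v, if u < v then (if G.Adj u v then c u + c v else 0) else 0 := by
  have h := sum_lt_add_swap (fun u v => if G.Adj u v then c u else 0)
  have h1 : ∀ u v : Fin n, (if u < v then (if G.Adj u v then c u + c v else 0) else 0)
      = if u < v then (if G.Adj u v then c u else 0) + (if G.Adj v u then c v else 0) else 0 := by
    intro u v
    by_cases hG : G.Adj u v
    · simp [hG, hG.symm]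
    · simp [hG, G.adj_comm v u]
  simp only [h1, h, dotProduct, degVec_apply, Finset.mul_sum]
  refine Finset.sum_congr rfl fun u _ => Finset.sum_congr rfl fun v _ => ?_
  by_cases huv : u = v
  · simp [huv]
  · simp [huv]

theorem dotProduct_degVec_le {n : ℕ} (c : Fin n → ℝ) (G : SimpleGraph (Fin n)) :
    c ⬝ᵥ degVec G ≤ maxValue c := by
  classical
  rw [dotProduct_degVec, maxValue]
  refine Finset.sum_le_sum fun u _ => Finset.sum_le_sum fun v _ => ?_
  split_ifs
  · exact le_max_right _ _
  · exact le_max_left _ _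
  · exact le_rfl

theorem maxValue_comp_perm {n : ℕ} (c : Fin n → ℝ) (σ : Equiv.Perm (Fin n)) :
    maxValue (c ∘ σ) = maxValue c := by
  have key : ∀ d : Fin n → ℝ,
      maxValue d = ∑ u, ∑ v, if u ≠ v then max 0 (d u + d v) / 2 else 0 := by
    intro d
    rw [← sum_lt_add_swap, maxValue]
    refine Finset.sum_congr rfl fun u _ => Finset.sum_congr rfl fun v _ => ?_
    rw [add_comm (d v) (d u), add_halves]
  rw [key, key, ← Equiv.sum_comp σ (fun u => ∑ v, if u ≠ v then max 0 (c u + c v) / 2 else 0)]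
  refine Finset.sum_congr rfl fun u _ => ?_
  rw [← Equiv.sum_comp σ (fun v => if σ u ≠ v then max 0 (c (σ u) + c v) / 2 else 0)]
  refine Finset.sum_congr rfl fun v _ => ?_
  simp

theorem le_maxValue_of_mem {n : ℕ} (c : Fin n → ℝ) {x : Fin n → ℝ}
    (hx : x ∈ degreePartitionPolytope n) : c ⬝ᵥ x ≤ maxValue c := by
  have hconv : Convex ℝ {x : Fin n → ℝ | c ⬝ᵥ x ≤ maxValue c} :=
    convex_halfSpace_le ⟨fun _ _ => dotProduct_add _ _ _, fun _ _ => dotProduct_smul _ _ _⟩ _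
  refine convexHull_min ?_ hconv hx
  rintro _ ⟨d, ⟨-, G, σ, hd⟩, rfl⟩
  rw [Set.mem_ofPred_eq, ← maxValue_comp_perm c σ.symm]
  refine le_trans (le_of_eq ?_) (dotProduct_degVec_le _ G)
  simp only [dotProduct, Function.comp]
  rw [← Equiv.sum_comp σ (fun i => c (σ.symm i) * degVec G i)]
  simp [hd, degVec]

theorem antitone_of_mem {n : ℕ} {x : Fin n → ℝ} (hx : x ∈ degreePartitionPolytope n) :
    Antitone x := by
  intro i j hij
  have hconv : Convex ℝ {x : Fin n → ℝ | x j - x i ≤ 0} :=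
    convex_halfSpace_le ⟨fun x y => by simp only [Pi.add_apply]; ring,
      fun r x => by simp only [Pi.smul_apply, smul_eq_mul]; ring⟩ _
  have : x ∈ {x : Fin n → ℝ | x j - x i ≤ 0} := by
    refine convexHull_min ?_ hconv hx
    rintro _ ⟨d, ⟨hd, -⟩, rfl⟩
    simpa using hd hij
  exact sub_nonpos.1 this

open Classical in
theorem degVec_mem {n : ℕ} {G : SimpleGraph (Fin n)} (hG : Antitone (degVec G)) :
    degVec G ∈ degreePartitionPolytope n := by
  refine subset_convexHull ℝ _ ⟨fun i => G.degree i, ⟨?_, G, Equiv.refl _, fun i => ?_⟩, rfl⟩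
  · intro i j hij
    exact Nat.cast_le.1 (hG hij)
  · rfl

/-- Swapping `u` and `v` maps the neighbours of `v` injectively to neighbours of `u`. -/
theorem degVec_le {n : ℕ} {G : SimpleGraph (Fin n)} {u v : Fin n}
    (h : ∀ w, w ≠ u → w ≠ v → G.Adj v w → G.Adj u w) : degVec G v ≤ degVec G u := by
  classical
  rw [degVec_apply, degVec_apply, ← Equiv.sum_comp (Equiv.swap u v)]
  refine Finset.sum_le_sum fun w _ => ?_
  by_cases hu : w = u
  · simp [hu]
  by_cases hv : w = v
  · simp [hv, G.adj_comm]
  rw [Equiv.swap_apply_of_ne_of_ne hu hv]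
  by_cases hw : G.Adj v w
  · simp [hw, h w hu hv hw]
  · rw [if_neg hw]
    positivity

/-! ### Shifted graphs -/

/-- The graph whose edges are the pairs `u < v` satisfying `R u v`. -/
def relGraph {n : ℕ} (R : ℕ → ℕ → Prop) : SimpleGraph (Fin n) where
  Adj u v := (u < v ∧ R u v) ∨ (v < u ∧ R v u)
  symm := ⟨fun _ _ h => h.symm⟩
  loopless := ⟨fun u h => by simp at h⟩

/-- Relations whose pairs `a < b` form a down-set. -/
def Shifted (R : ℕ → ℕ → Prop) : Prop :=
  ∀ a b a' b', a < b → a' < b' → a' ≤ a → b' ≤ b → R a b → R a' b'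

theorem Shifted.degVec_mem {n : ℕ} {R : ℕ → ℕ → Prop} (hR : Shifted R) :
    degVec (relGraph R : SimpleGraph (Fin n)) ∈ degreePartitionPolytope n := by
  apply _root_.degVec_mem
  intro u v huv
  apply degVec_le
  intro w hwu hwv h
  have huv' : (u : ℕ) ≤ v := huv
  have hne : (w : ℕ) ≠ u := fun h => hwu (Fin.ext h)
  simp only [relGraph, Fin.lt_def] at h ⊢
  rcases h with ⟨h1, h2⟩ | ⟨h1, h2⟩
  · exact Or.inl ⟨by omega, hR _ _ _ _ h1 (by omega) huv' le_rfl h2⟩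
  · rcases lt_or_gt_of_ne hne with h3 | h3
    · exact Or.inr ⟨h3, hR _ _ _ _ h1 h3 le_rfl huv' h2⟩
    · exact Or.inl ⟨h3, hR _ _ _ _ h1 h3 (by omega) (by omega) h2⟩

open Classical in
theorem dotProduct_degVec_relGraph {n : ℕ} (c : Fin n → ℝ) (R : ℕ → ℕ → Prop) :
    c ⬝ᵥ degVec (relGraph R) = ∑ u : Fin n, ∑ v : Fin n,
      if u < v then (if R u v then c u + c v else 0) else 0 := by
  rw [dotProduct_degVec]
  refine Finset.sum_congr rfl fun u _ => Finset.sum_congr rfl fun v _ => ?_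
  by_cases huv : u < v
  · simp [huv, relGraph, huv.not_gt]
  · simp [huv]

theorem dotProduct_degVec_relGraph_sub {n : ℕ} (c : Fin n → ℝ) {R R' : ℕ → ℕ → Prop}
    {i j : Fin n} (hij : i < j) (hR : ¬ R i j)
    (h : ∀ a b, a < b → (R' a b ↔ R a b ∨ (a = i ∧ b = j))) :
    c ⬝ᵥ degVec (relGraph R') = c ⬝ᵥ degVec (relGraph R) + (c i + c j) := by
  classical
  have h1 : ∀ u v : Fin n, (if u < v then (if R' u v then c u + c v else 0) else 0)
      = (if u < v then (if R u v then c u + c v else 0) else 0)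
        + (if v = j then (if u = i then c i + c j else 0) else 0) := by
    intro u v
    by_cases huv : u < v
    · by_cases h2 : u = i ∧ v = j
      · obtain ⟨rfl, rfl⟩ := h2
        simp [huv, h u v huv, hR]
      · have h3 : ¬ ((u : ℕ) = i ∧ (v : ℕ) = j) := fun h4 => h2 ⟨Fin.ext h4.1, Fin.ext h4.2⟩
        have h4 : R' u v ↔ R u v := by rw [h u v huv]; tauto
        have h5 : (if v = j then (if u = i then c i + c j else 0) else 0) = 0 := by
          split_ifs with h6 h7
          · exact absurd ⟨h7, h6⟩ h2
          · rfl
          · rfl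
        rw [h5, add_zero]
        simp only [h4]
    · have h5 : (if v = j then (if u = i then c i + c j else 0) else 0) = 0 := by
        split_ifs with h6 h7
        · subst h6 h7
          exact absurd hij huv
        · rfl
        · rfl
      simp [huv, h5]
  simp only [dotProduct_degVec_relGraph, h1, Finset.sum_add_distrib]
  simp

/-! ### Threshold graphs and functionals that are not decreasing -/

/-- The threshold graph of a vector `c`. -/
def thresholdGraph {n : ℕ} (c : Fin n → ℝ) : SimpleGraph (Fin n) where
  Adj u v := u ≠ v ∧ 0 < c u + c v
  symm := ⟨fun _ _ h => ⟨h.1.symm, add_comm (c _) (c _) ▸ h.2⟩⟩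
  loopless := ⟨fun _ h => h.1 rfl⟩

theorem dotProduct_degVec_thresholdGraph {n : ℕ} (c : Fin n → ℝ) :
    c ⬝ᵥ degVec (thresholdGraph c) = maxValue c := by
  classical
  rw [dotProduct_degVec, maxValue]
  refine Finset.sum_congr rfl fun u _ => Finset.sum_congr rfl fun v _ => ?_
  by_cases huv : u < v
  · by_cases h : 0 < c u + c v
    · simp [huv, thresholdGraph, huv.ne, h, h.le]
    · simp [huv, thresholdGraph, h, not_lt.1 h]
  · simp [huv]

theorem degVec_thresholdGraph_le {n : ℕ} {c : Fin n → ℝ} {u v : Fin n} (h : c v ≤ c u) :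
    degVec (thresholdGraph c) v ≤ degVec (thresholdGraph c) u :=
  degVec_le fun w hwu _ hw => ⟨hwu.symm, by linarith [hw.2]⟩

/-- Perturbing an antitone vector by a vector that respects its ties. -/
theorem exists_antitone_sub_smul {n : ℕ} {c d : Fin n → ℝ} (hc : Antitone c)
    (h : ∀ i j, c i = c j → d i = d j) : ∃ ε > 0, Antitone (c - (ε : ℝ) • d) := by
  have hloc : ∀ p : Fin n × Fin n, ∀ᶠ ε : ℝ in nhdsWithin 0 (Set.Ioi 0),
      p.1 ≤ p.2 → (c - ε • d) p.2 ≤ (c - ε • d) p.1 := by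
    rintro ⟨i, j⟩
    by_cases hij : i ≤ j
    · rcases (hc hij).eq_or_lt with h1 | h1
      · filter_upwards with ε _
        simp [h1, h _ _ h1]
      · have hcont : Filter.Tendsto (fun ε : ℝ => (c - ε • d) i - (c - ε • d) j)
            (nhdsWithin 0 (Set.Ioi 0)) (nhds ((c - (0 : ℝ) • d) i - (c - (0 : ℝ) • d) j)) := by
          apply Filter.Tendsto.mono_left _ nhdsWithin_le_nhds
          apply Continuous.tendsto
          simp only [Pi.sub_apply, Pi.smul_apply, smul_eq_mul]
          fun_prop
        have hpos : 0 < (c - (0 : ℝ) • d) i - (c - (0 : ℝ) • d) j := by simpa using h1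
        filter_upwards [hcont.eventually (lt_mem_nhds hpos)] with ε hε _
        exact (sub_pos.1 hε).le
    · filter_upwards with ε h1
      exact absurd h1 hij
  obtain ⟨ε, h1, h2⟩ := ((Filter.eventually_all.2 hloc).and self_mem_nhdsWithin).exists
  exact ⟨ε, h2, fun i j hij => h1 (i, j) hij⟩

/-- The maximizers over the polytope of a functional that is not weakly decreasing lie in the
face where two consecutive coordinates agree. -/
theorem exists_eq_of_not_antitone {n : ℕ} {c : Fin n → ℝ} (hc : ¬ Antitone c) :
    ∃ i j : Fin n, (j : ℕ) = i + 1 ∧ ∀ x ∈ degreePartitionPolytope n,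
      (∀ y ∈ degreePartitionPolytope n, c ⬝ᵥ y ≤ c ⬝ᵥ x) → x i = x j := by
  obtain ⟨d, hd, h0, hpol⟩ := exists_antitone_projection c
  have he : c - d ≠ 0 := by
    intro h
    rw [sub_eq_zero] at h
    exact hc (h ▸ hd)
  obtain ⟨i, j, hij, hx⟩ := exists_eq_of_polar he hpol
  refine ⟨i, j, hij, fun x hxP hmax => hx x (antitone_of_mem hxP) ?_⟩
  set t := degVec (thresholdGraph d) with ht
  have htP : t ∈ degreePartitionPolytope n :=
    degVec_mem fun u v huv => degVec_thresholdGraph_le (hd huv)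
  -- Equal entries of `d` give equal degrees, so `d - ε • t` stays decreasing. Polarity and `(c - d)
  -- ⬝ᵥ d = 0` then give `0 ≤ (c - d) ⬝ᵥ t`.
  obtain ⟨ε, hε, hanti⟩ := exists_antitone_sub_smul (d := t) hd fun u v huv =>
    le_antisymm (degVec_thresholdGraph_le huv.le) (degVec_thresholdGraph_le huv.ge)
  have h1 := hpol _ hanti
  rw [dotProduct_sub, h0, dotProduct_smul, smul_eq_mul] at h1
  have h2 : 0 ≤ (c - d) ⬝ᵥ t := by
    by_contra! h3
    nlinarith
  have h3 := hmax t htP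
  have h4 := le_maxValue_of_mem d hxP
  rw [← dotProduct_degVec_thresholdGraph d] at h4
  have h5 := hpol x (antitone_of_mem hxP)
  rw [sub_dotProduct] at h2 h5 ⊢
  linarith

/-! ### The FHM inequalities and decreasing functionals -/

/-- The coefficient vector of the Fulkerson-Hoffman-McAndrew inequality. -/
def fhmVec (n k l : ℕ) : Fin n → ℝ :=
  fun i => (if (i : ℕ) < k then 1 else 0) - (if n ≤ (i : ℕ) + l then 1 else 0)

theorem fhmLhs_eq_dotProduct (n k l : ℕ) (x : Fin n → ℝ) :
    fhmLhs n k l x = fhmVec n k l ⬝ᵥ x := by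
  simp [fhmLhs, dotProduct, fhmVec, sub_mul, Finset.sum_filter]

theorem sum_fin_ite_lt {n q : ℕ} (hq : q ≤ n) :
    ∑ v : Fin n, (if (v : ℕ) < q then (1 : ℝ) else 0) = q := by
  rw [Fin.sum_univ_eq_sum_range (fun i => if i < q then (1 : ℝ) else 0) n, Finset.sum_boole]
  have : (Finset.range n).filter (fun i => i < q) = Finset.range q := by
    ext i
    simp only [Finset.mem_filter, Finset.mem_range]
    omega
  rw [this, Finset.card_range]

/-- The positive part of `c u + c v` counts the orderings of the pair whose first entry is among the
first `k` indices and whose second is among the first `n - l`. There are `k(n - l) - k` such ordered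
pairs off the diagonal. -/
theorem maxValue_fhmVec {n k l : ℕ} (h : k + l ≤ n) :
    maxValue (fhmVec n k l) = fhmRhs n k l := by
  have h1 := sum_lt_add_swap (n := n)
    (fun u v => if (u : ℕ) < k then (if (v : ℕ) < n - l then 1 else 0) else 0)
  have h2 : maxValue (fhmVec n k l) = ∑ u : Fin n, ∑ v : Fin n, if u < v then
      ((if (u : ℕ) < k then (if (v : ℕ) < n - l then (1 : ℝ) else 0) else 0) +
        (if (v : ℕ) < k then (if (u : ℕ) < n - l then (1 : ℝ) else 0) else 0)) else 0 := by
    refine Finset.sum_congr rfl fun u _ => Finset.sum_congr rfl fun v _ => ?_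
    split_ifs with h3 <;> simp only [fhmVec] <;> split_ifs <;> first | omega | norm_num
  have h3 : ∀ u v : Fin n, (if u ≠ v then
      (if (u : ℕ) < k then (if (v : ℕ) < n - l then (1 : ℝ) else 0) else 0) else 0)
      = (if (u : ℕ) < k then 1 else 0) * (if (v : ℕ) < n - l then 1 else 0)
        - (if v = u then (if (u : ℕ) < k then 1 else 0) else 0) := by
    intro u v
    by_cases huv : v = u
    · subst huv
      simp only [ne_eq, not_true_eq_false, if_false, if_true]
      split_ifs <;> first | omega | norm_num
    · simp only [ne_eq, Ne.symm huv, not_false_eq_true, huv, if_true, if_false]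
      split_ifs <;> norm_num
  rw [h2, h1]
  simp only [h3, Finset.sum_sub_distrib, Finset.sum_ite_eq', Finset.mem_univ,
    if_true, ← Finset.mul_sum, ← Finset.sum_mul]
  rw [sum_fin_ite_lt (by omega), sum_fin_ite_lt (by omega), fhmRhs, Nat.cast_sub (by omega)]
  ring

theorem fhmLhs_le {n k l : ℕ} (h : k + l ≤ n) {x : Fin n → ℝ}
    (hx : x ∈ degreePartitionPolytope n) : fhmLhs n k l x ≤ fhmRhs n k l := by
  rw [fhmLhs_eq_dotProduct, ← maxValue_fhmVec h]
  exact le_maxValue_of_mem _ hx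

theorem exists_iff_lt_of_downward {n : ℕ} {p : Fin n → Prop} (hp : ∀ i j, i ≤ j → p j → p i) :
    ∃ k ≤ n, ∀ i : Fin n, p i ↔ (i : ℕ) < k := by
  classical
  have hex : ∃ k, ∀ i : Fin n, k ≤ (i : ℕ) → ¬ p i := ⟨n, fun i hi => by omega⟩
  refine ⟨Nat.find hex, Nat.find_min' hex fun i hi => by omega, fun i => ⟨fun hi => ?_, fun hi => ?_⟩⟩
  · by_contra! h
    exact Nat.find_spec hex i h hi
  · have := Nat.find_min hex hi
    push Not at this
    obtain ⟨j, hij, hj⟩ := this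
    exact hp i j hij hj

/-- The maximizers over the polytope of a nonzero weakly decreasing functional satisfy some
Fulkerson-Hoffman-McAndrew inequality with equality. -/
theorem exists_fhm_tight_of_antitone {n : ℕ} {c : Fin n → ℝ} (hc : Antitone c) (hc0 : c ≠ 0) :
    ∃ k l : ℕ, 1 ≤ k + l ∧ k + l ≤ n ∧ ∀ x ∈ degreePartitionPolytope n,
      (∀ y ∈ degreePartitionPolytope n, c ⬝ᵥ y ≤ c ⬝ᵥ x) → fhmVec n k l ⬝ᵥ x = fhmRhs n k l := by
  classical
  obtain ⟨k, hk, hk'⟩ := exists_iff_lt_of_downward (p := fun i => 0 < c i)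
    fun i j hij h => h.trans_le (hc hij)
  obtain ⟨q, hq, hq'⟩ := exists_iff_lt_of_downward (p := fun i => 0 ≤ c i)
    fun i j hij h => h.trans (hc hij)
  obtain ⟨i₀, hi₀⟩ : ∃ i, c i ≠ 0 := Function.ne_iff.1 hc0
  have hkq : k ≤ q := by
    by_contra! h
    have h1 := (hk' ⟨q, by omega⟩).2 h
    have h2 := (hq' ⟨q, by omega⟩).1 h1.le
    simp at h2
  have hne : 1 ≤ k + (n - q) := by
    rcases lt_or_gt_of_ne hi₀ with h | h
    · have h1 := mt (hq' i₀).2 (not_le.2 h)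
      omega
    · have h1 := (hk' i₀).1 h
      omega
  obtain ⟨j, hj, hjmin⟩ := Finset.exists_min_image (Finset.univ.filter fun i => c i ≠ 0)
    (fun i => |c i|) ⟨i₀, by simpa using hi₀⟩
  obtain ⟨t, rfl⟩ : ∃ t, t = |c j| := ⟨_, rfl⟩
  set t := |c j| with ht
  have ht0 : 0 < t := abs_pos.2 (by simpa using hj)
  have htpos : ∀ i, 0 < c i → t ≤ c i := fun i hi =>
    (hjmin i (by simp [hi.ne'])).trans_eq (abs_of_pos hi)
  have htneg : ∀ i, c i < 0 → c i ≤ -t := fun i hi => by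
    have := (hjmin i (by simp [hi.ne])).trans_eq (abs_of_neg hi)
    linarith
  set a := fhmVec n k (n - q) with ha
  have ha' : ∀ i, (0 < c i ∧ a i = 1) ∨ (c i = 0 ∧ a i = 0) ∨ (c i < 0 ∧ a i = -1) := by
    intro i
    have h1 := hk' i
    have h2 := hq' i
    have h3 := i.2
    simp only [ha, fhmVec]
    rcases lt_trichotomy (c i) 0 with h | h | h
    · have h4 := mt h2.2 (not_le.2 h)
      rw [if_neg (by omega), if_pos (by omega)]
      exact Or.inr (Or.inr ⟨h, by norm_num⟩)
    · have h4 := h2.1 h.ge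
      have h5 := mt h1.2 h.le.not_gt
      rw [if_neg (by omega), if_neg (by omega)]
      exact Or.inr (Or.inl ⟨h, by norm_num⟩)
    · have h4 := h1.1 h
      rw [if_pos (by omega), if_neg (by omega)]
      exact Or.inl ⟨h, by norm_num⟩
  -- By the choice of `t`, each pair sum of `c - t • a` stays on the same side of zero when the
  -- corresponding sum of `a` is nonzero, and is unchanged when that sum is zero.
  have hmax : maxValue c = t * maxValue a + maxValue (c - t • a) := by
    simp only [maxValue, Finset.mul_sum, ← Finset.sum_add_distrib]
    refine Finset.sum_congr rfl fun u _ => Finset.sum_congr rfl fun v _ => ?_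
    split_ifs with huv
    · simp only [Pi.sub_apply, Pi.smul_apply, smul_eq_mul]
      have h0 := hc huv.le
      rcases ha' u with ⟨h1, h2⟩ | ⟨h1, h2⟩ | ⟨h1, h2⟩ <;>
      rcases ha' v with ⟨h3, h4⟩ | ⟨h3, h4⟩ | ⟨h3, h4⟩ <;> rw [h2, h4]
      · have h5 := htpos u h1
        have h6 := htpos v h3
        rw [max_eq_right (by linarith), max_eq_right (by norm_num), max_eq_right (by linarith)]
        ring
      · have h5 := htpos u h1
        rw [max_eq_right (by linarith), max_eq_right (by norm_num), max_eq_right (by linarith)]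
        ring
      · rw [max_eq_left (a := (0 : ℝ)) (b := 1 + -1) (by norm_num)]
        ring_nf
      · linarith
      · simp [h1, h3]
      · have h5 := htneg v h3
        rw [max_eq_left (by linarith), max_eq_left (by norm_num), max_eq_left (by linarith)]
        ring
      · linarith
      · linarith
      · have h5 := htneg u h1
        have h6 := htneg v h3
        rw [max_eq_left (by linarith), max_eq_left (by norm_num), max_eq_left (by linarith)]
        ring
    · simp
  refine ⟨k, n - q, hne, by omega, fun x hx hxmax => ?_⟩
  have hrhs : maxValue a = fhmRhs n k (n - q) := maxValue_fhmVec (by omega)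
  have h1 := hxmax _ (degVec_mem fun u v huv => degVec_thresholdGraph_le (hc huv))
  rw [dotProduct_degVec_thresholdGraph, hmax] at h1
  have h2 := le_maxValue_of_mem a hx
  have h3 := le_maxValue_of_mem (c - t • a) hx
  rw [sub_dotProduct, smul_dotProduct, smul_eq_mul] at h3
  rw [← hrhs]
  nlinarith

/-! ### The listed FHM faces are facets -/

/-- Shifted graphs whose degree sequence satisfies the inequality with equality. -/
theorem fhmVec_dotProduct_relGraph {n k l : ℕ} (h : k + l ≤ n) {R : ℕ → ℕ → Prop}
    (h1 : ∀ a b, a < b → a < k → b < n - l → R a b)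
    (h2 : ∀ a b, a < b → R a b → a < k ∨ b < n - l) :
    fhmVec n k l ⬝ᵥ degVec (relGraph R) = fhmRhs n k l := by
  classical
  rw [← maxValue_fhmVec h, dotProduct_degVec_relGraph, maxValue]
  refine Finset.sum_congr rfl fun u _ => Finset.sum_congr rfl fun v _ => ?_
  split_ifs with huv hR
  · have h3 := h2 u v huv hR
    rw [max_eq_right]
    simp only [fhmVec]
    split_ifs <;> first | omega | norm_num
  · rw [max_eq_left]
    have : ¬ ((u : ℕ) < k ∧ (v : ℕ) < n - l) := fun h => hR (h1 u v huv h.1 h.2)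
    have := Fin.lt_def.1 huv
    simp only [fhmVec]
    split_ifs <;> first | omega | norm_num
  · rfl

section FhmFace

variable {n k l : ℕ} {w : Fin n → ℝ}

theorem relGraph_mem_fhmFace (h : k + l ≤ n) {R : ℕ → ℕ → Prop} (hR : Shifted R)
    (h1 : ∀ a b, a < b → a < k → b < n - l → R a b)
    (h2 : ∀ a b, a < b → R a b → a < k ∨ b < n - l) :
    degVec (relGraph R) ∈
      {x ∈ degreePartitionPolytope n | fhmVec n k l ⬝ᵥ x = fhmRhs n k l} :=
  ⟨hR.degVec_mem, fhmVec_dotProduct_relGraph h h1 h2⟩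

/-- Edges between the first `k` and the last `l` vertices are free on this face. Adding them in
lexicographic order keeps the graph shifted, and the step adding `ij` changes the value of `w` by `w
i + w j`. -/
theorem add_eq_zero_of_constOn_fhmFace (h : k + l ≤ n)
    (hw : ConstOn w {x ∈ degreePartitionPolytope n | fhmVec n k l ⬝ᵥ x = fhmRhs n k l})
    {i j : Fin n} (hi : (i : ℕ) < k) (hj : n - l ≤ j) : w i + w j = 0 := by
  have hij : i < j := by
    rw [Fin.lt_def]
    omega
  have h1 := dotProduct_degVec_relGraph_sub w (i := i) (j := j) hij
    (R := fun a b => (a < k ∧ b < n - l) ∨ a < i ∨ (a = i ∧ b < j))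
    (R' := fun a b => (a < k ∧ b < n - l) ∨ a < i ∨ (a = i ∧ b ≤ j))
    (by omega) (fun a b _ => by omega)
  have h2 := hw _ (relGraph_mem_fhmFace h
      (R := fun a b => (a < k ∧ b < n - l) ∨ a < i ∨ (a = i ∧ b < j))
      (fun a b a' b' _ _ _ _ _ => by omega) (fun a b _ _ _ => by omega) (fun a b _ _ => by omega))
    _ (relGraph_mem_fhmFace h
      (R := fun a b => (a < k ∧ b < n - l) ∨ a < i ∨ (a = i ∧ b ≤ j))
      (fun a b a' b' _ _ _ _ _ => by omega) (fun a b _ _ _ => by omega) (fun a b _ _ => by omega))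
  linarith

/-- Edges inside the middle block are free too. Growing a star at `k` and then closing a triangle
gives three vanishing pair sums, which is why the block needs three vertices. -/
theorem eq_zero_of_constOn_fhmFace (h : k + l + 3 ≤ n)
    (hw : ConstOn w {x ∈ degreePartitionPolytope n | fhmVec n k l ⬝ᵥ x = fhmRhs n k l})
    {i : Fin n} (hi : k ≤ i) (hi' : (i : ℕ) < n - l) : w i = 0 := by
  have hkl : k + l ≤ n := by omega
  have hstar : ∀ j : Fin n, k < j → (j : ℕ) < n - l → w ⟨k, by omega⟩ + w j = 0 := by
    intro j hj hj'
    have h1 := dotProduct_degVec_relGraph_sub w (i := ⟨k, by omega⟩) (j := j) hj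
      (R := fun a b => (a < k ∧ b < n - l) ∨ (a ≤ k ∧ b < j))
      (R' := fun a b => (a < k ∧ b < n - l) ∨ (a ≤ k ∧ b ≤ j))
      (by simp) (fun a b _ => by simp only; omega)
    have h2 := hw _ (relGraph_mem_fhmFace hkl
        (R := fun a b => (a < k ∧ b < n - l) ∨ (a ≤ k ∧ b < j))
        (fun a b a' b' _ _ _ _ _ => by omega) (fun a b _ _ _ => by omega)
        (fun a b _ _ => by omega))
      _ (relGraph_mem_fhmFace hkl
        (R := fun a b => (a < k ∧ b < n - l) ∨ (a ≤ k ∧ b ≤ j))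
        (fun a b a' b' _ _ _ _ _ => by omega) (fun a b _ _ _ => by omega)
        (fun a b _ _ => by omega))
    linarith
  have h1 := dotProduct_degVec_relGraph_sub w (i := ⟨k + 1, by omega⟩) (j := ⟨k + 2, by omega⟩)
    (by simp)
    (R := fun a b => (a < k ∧ b < n - l) ∨ (a ≤ k ∧ b ≤ k + 2))
    (R' := fun a b => (a < k ∧ b < n - l) ∨ (a ≤ k + 1 ∧ b ≤ k + 2))
    (by simp) (fun a b _ => by simp only; omega)
  have h2 := hw _ (relGraph_mem_fhmFace hkl
      (R := fun a b => (a < k ∧ b < n - l) ∨ (a ≤ k ∧ b ≤ k + 2))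
      (fun a b a' b' _ _ _ _ _ => by omega) (fun a b _ _ _ => by omega)
      (fun a b _ _ => by omega))
    _ (relGraph_mem_fhmFace hkl
      (R := fun a b => (a < k ∧ b < n - l) ∨ (a ≤ k + 1 ∧ b ≤ k + 2))
      (fun a b a' b' _ _ _ _ _ => by omega) (fun a b _ _ _ => by omega)
      (fun a b _ _ => by omega))
  have h3 := hstar ⟨k + 1, by omega⟩ (by simp) (by simp only; omega)
  have h4 := hstar ⟨k + 2, by omega⟩ (by simp) (by simp only; omega)
  have h5 : w ⟨k, by omega⟩ = 0 := by linarith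
  rcases hi.eq_or_lt with h6 | h6
  · have : i = ⟨k, by omega⟩ := Fin.ext h6.symm
    rw [this, h5]
  · have := hstar i h6 hi'
    linarith

theorem fhmVec_ne_zero (h0 : 1 ≤ k + l) (h : k + l ≤ n) : fhmVec n k l ≠ 0 := by
  intro h1
  rcases Nat.eq_zero_or_pos k with h2 | h2
  · have := congrFun h1 ⟨n - 1, by omega⟩
    simp only [fhmVec, Pi.zero_apply] at this
    rw [if_neg (by omega), if_pos (by omega)] at this
    norm_num at this
  · have := congrFun h1 ⟨0, by omega⟩
    simp only [fhmVec, Pi.zero_apply] at this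
    rw [if_pos (by omega), if_neg (by omega)] at this
    norm_num at this

theorem fhmFace_nonempty (h : k + l ≤ n) :
    ∃ x ∈ degreePartitionPolytope n, fhmVec n k l ⬝ᵥ x = fhmRhs n k l :=
  ⟨_, relGraph_mem_fhmFace h (R := fun a b => a < k ∧ b < n - l)
    (fun a b a' b' _ _ _ _ _ => by omega) (fun a b _ _ _ => by omega) (fun a b _ _ => by omega)⟩

theorem isFacet_fhmFace (hP : affineDim (degreePartitionPolytope n) = n) (hn : 4 ≤ n)
    (hkl : FacetPair n k l) :
    IsFacet (degreePartitionPolytope n)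
      {x ∈ degreePartitionPolytope n | fhmVec n k l ⬝ᵥ x = fhmRhs n k l} := by
  have hle : k + l ≤ n := by unfold FacetPair at hkl; omega
  have hpos : 1 ≤ k + l := by unfold FacetPair at hkl; omega
  refine isFacet_of_constOn hP (fhmVec_ne_zero hpos hle)
    (fun x hx => by rw [← fhmLhs_eq_dotProduct]; exact fhmLhs_le hle hx)
    (fhmFace_nonempty hle) fun w hw => ?_
  have hKL : ∀ i j : Fin n, (i : ℕ) < k → n - l ≤ j → w i + w j = 0 :=
    fun i j => add_eq_zero_of_constOn_fhmFace hle hw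
  have hM : ∀ i : Fin n, k ≤ i → (i : ℕ) < n - l → w i = 0 := by
    intro i hi hi'
    exact eq_zero_of_constOn_fhmFace (by unfold FacetPair at hkl; omega) hw hi hi'
  -- When `k` and `l` are positive, the relations `w i + w j = 0` link the two outer blocks.
  -- Otherwise the only nonempty outer block is a single vertex.
  obtain ⟨r, hr, hr'⟩ : ∃ r : ℝ, (∀ i : Fin n, (i : ℕ) < k → w i = r) ∧
      ∀ i : Fin n, n - l ≤ i → w i = -r := by
    rcases Nat.eq_zero_or_pos l with hl | hl
    · refine ⟨w ⟨0, by omega⟩, fun i hi => congrArg w (Fin.ext ?_), fun i hi => by omega⟩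
      unfold FacetPair at hkl
      simp only
      omega
    · refine ⟨-w ⟨n - 1, by omega⟩, fun i hi => ?_, fun i hi => ?_⟩
      · have := hKL i ⟨n - 1, by omega⟩ hi (by simp only; omega)
        linarith
      · rcases Nat.eq_zero_or_pos k with hk | hk
        · rw [neg_neg]
          refine congrArg w (Fin.ext ?_)
          unfold FacetPair at hkl
          simp only
          omega
        · have h1 := hKL ⟨0, by omega⟩ i hk hi
          have h2 := hKL ⟨0, by omega⟩ ⟨n - 1, by omega⟩ hk (by simp only; omega)
          linarith
  refine ⟨r, funext fun i => ?_⟩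
  simp only [Pi.smul_apply, fhmVec, smul_eq_mul]
  split_ifs with h1 h2 h2
  · omega
  · rw [hr i h1]
    ring
  · rw [hr' i (by omega)]
    ring
  · rw [hM i (by omega) (by omega)]
    ring

end FhmFace

/-! ### The facets where consecutive coordinates agree -/

section EqualCoordinates

variable {n : ℕ}

/-- The coefficient vector of `x i ≥ x j`, written as `eqVec i j ⬝ᵥ x ≤ 0`. -/
def eqVec (i j : Fin n) : Fin n → ℝ := Pi.single j 1 - Pi.single i 1

theorem eqVec_dotProduct (i j : Fin n) (x : Fin n → ℝ) : eqVec i j ⬝ᵥ x = x j - x i := by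
  simp [eqVec, sub_dotProduct]

theorem setOf_eq_eq_eqVec_face (P : Set (Fin n → ℝ)) (i j : Fin n) :
    {x ∈ P | x i = x j} = {x ∈ P | eqVec i j ⬝ᵥ x = 0} := by
  ext x
  simp only [eqVec_dotProduct, Set.mem_ofPred_eq, sub_eq_zero, eq_comm]

theorem degVec_clique {p : ℕ} (hp : p ≤ n) (u : Fin n) :
    degVec (relGraph fun _ b => b < p) u = if (u : ℕ) < p then (p : ℝ) - 1 else 0 := by
  classical
  rw [degVec_apply]
  split_ifs with hu
  · have h1 : ∀ v : Fin n, (if (relGraph fun _ b => b < p).Adj u v then (1 : ℝ) else 0)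
        = (if (v : ℕ) < p then 1 else 0) - if v = u then 1 else 0 := by
      intro v
      simp only [relGraph, Fin.lt_def, Fin.ext_iff]
      split_ifs <;> first | omega | norm_num
    simp [h1, sum_fin_ite_lt hp]
  · refine Finset.sum_eq_zero fun v _ => if_neg ?_
    simp only [relGraph, Fin.lt_def]
    omega

theorem degVec_star (u : Fin n) :
    degVec (relGraph fun a _ => a < 1) u = 1 + if (u : ℕ) = 0 then (n : ℝ) - 2 else 0 := by
  classical
  have hn : 1 ≤ n := Nat.one_le_of_lt u.2
  rw [degVec_apply]
  split_ifs with hu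
  · have h1 : ∀ v : Fin n, (if (relGraph fun a _ => a < 1).Adj u v then (1 : ℝ) else 0)
        = 1 - if v = u then 1 else 0 := by
      intro v
      simp only [relGraph, Fin.lt_def, Fin.ext_iff]
      split_ifs <;> first | omega | norm_num
    simp only [h1, Finset.sum_sub_distrib, Finset.sum_ite_eq', Finset.mem_univ, if_true,
      Finset.sum_const, Finset.card_univ, Fintype.card_fin, nsmul_eq_mul]
    ring
  · have h1 : ∀ v : Fin n, (if (relGraph fun a _ => a < 1).Adj u v then (1 : ℝ) else 0)
        = if (v : ℕ) < 1 then 1 else 0 := by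
      intro v
      simp only [relGraph, Fin.lt_def]
      split_ifs <;> first | omega | norm_num
    simp only [h1]
    rw [sum_fin_ite_lt hn]
    simp

/-- Functionals constant on the face `x i = x j`, with `j` the successor of `i`. -/
theorem eq_smul_eqVec_of_constOn (hn : 3 ≤ n) {i j : Fin n} (hij : (j : ℕ) = i + 1)
    {w : Fin n → ℝ} (hw : ConstOn w {x ∈ degreePartitionPolytope n | x i = x j}) :
    ∃ r : ℝ, w = r • eqVec i j := by
  -- In terms of partial sums, the goal becomes `W p = 0` for all `p ≠ j`.
  set W : ℕ → ℝ := fun p => ∑ u : Fin n, if (u : ℕ) < p then w u else 0 with hW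
  have hW0 : W 0 = 0 := by simp [hW]
  have hWsucc : ∀ u : Fin n, w u = W (u + 1) - W u := by
    intro u
    have h1 : ∀ v : Fin n, (if (v : ℕ) < u + 1 then w v else 0)
        = (if (v : ℕ) < u then w v else 0) + if v = u then w v else 0 := by
      intro v
      simp only [Fin.ext_iff]
      split_ifs <;> first | omega | simp
    simp only [hW, h1, Finset.sum_add_distrib]
    simp
  have hclique : ∀ p ≤ n, p ≠ j → degVec (relGraph fun _ b => b < p) ∈
      {x ∈ degreePartitionPolytope n | x i = x j} := by
    intro p hp hpj
    refine ⟨Shifted.degVec_mem fun a b a' b' _ _ _ _ _ => by omega, ?_⟩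
    rw [degVec_clique hp, degVec_clique hp]
    split_ifs <;> first | omega | rfl
  have hval : ∀ p ≤ n, w ⬝ᵥ degVec (relGraph fun _ b => b < p) = ((p : ℝ) - 1) * W p := by
    intro p hp
    simp only [dotProduct, hW, Finset.mul_sum]
    refine Finset.sum_congr rfl fun u _ => ?_
    rw [degVec_clique hp]
    split_ifs <;> ring
  have hconst : ∀ x ∈ {x ∈ degreePartitionPolytope n | x i = x j}, w ⬝ᵥ x = 0 := by
    intro x hx
    rw [hw x hx _ (hclique 0 (by omega) (by omega)), hval 0 (by omega), hW0, mul_zero]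
  have hWp : ∀ p ≤ n, 2 ≤ p → p ≠ j → W p = 0 := by
    intro p hp hp2 hpj
    have h1 := hconst _ (hclique p hp hpj)
    rw [hval p hp] at h1
    have : (2 : ℝ) ≤ p := by exact_mod_cast hp2
    exact (mul_eq_zero.1 h1).resolve_left (by linarith)
  -- The clique on one vertex has no edges and says nothing about `W 1`; the star at vertex `0`
  -- replaces it.
  have hW1 : (j : ℕ) ≠ 1 → W 1 = 0 := by
    intro hj
    have h1 := hconst (degVec (relGraph fun a _ => a < 1))
      ⟨Shifted.degVec_mem fun a b a' b' _ _ _ _ _ => by omega, by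
        rw [degVec_star, degVec_star, if_neg (by omega), if_neg (by omega)]⟩
    have h2 : w ⬝ᵥ degVec (relGraph fun a _ => a < 1) = W n + ((n : ℝ) - 2) * W 1 := by
      simp only [dotProduct, hW, Finset.mul_sum, ← Finset.sum_add_distrib]
      refine Finset.sum_congr rfl fun u _ => ?_
      rw [degVec_star, if_pos u.2]
      simp only [Nat.lt_one_iff]
      split_ifs <;> ring
    rw [h2, hWp n le_rfl (by omega) (by omega), zero_add] at h1
    have : (3 : ℝ) ≤ n := by exact_mod_cast hn
    exact (mul_eq_zero.1 h1).resolve_left (by linarith)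
  have hWall : ∀ p ≤ n, p ≠ j → W p = 0 := by
    intro p hp hpj
    rcases Nat.lt_or_ge p 2 with h | h
    · interval_cases p
      · exact hW0
      · exact hW1 hpj.symm
    · exact hWp p hp h hpj
  refine ⟨-W j, funext fun u => ?_⟩
  rw [hWsucc u]
  simp only [eqVec, Pi.smul_apply, Pi.sub_apply, Pi.single_apply, Fin.ext_iff, smul_eq_mul]
  have := u.2
  split_ifs with h1 h2 h2
  · omega
  · rw [h1, hWall (j + 1) (by omega) (by omega)]
    ring
  · rw [h2, ← hij, hWall i (by omega) (by omega)]
    ring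
  · rw [hWall _ (by omega) (by omega), hWall _ (by omega) (by omega)]
    ring

/-- A functional constant on the polytope is a multiple of both `eqVec 0 1` and `eqVec 1 2`, hence
zero. -/
theorem affineDim_degreePartitionPolytope (hn : 3 ≤ n) :
    affineDim (degreePartitionPolytope n) = n := by
  refine affineDim_eq_of_constOn_eq_zero fun w hw => ?_
  obtain ⟨r, hr⟩ := eq_smul_eqVec_of_constOn hn (i := ⟨0, by omega⟩) (j := ⟨1, by omega⟩) rfl
    fun x hx y hy => hw x hx.1 y hy.1
  obtain ⟨s, hs⟩ := eq_smul_eqVec_of_constOn hn (i := ⟨1, by omega⟩) (j := ⟨2, by omega⟩) rfl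
    fun x hx y hy => hw x hx.1 y hy.1
  have h1 := congrFun hr ⟨0, by omega⟩
  rw [hs] at h1
  simp [eqVec] at h1
  simp [hr, ← h1]

theorem eqVec_ne_zero {i j : Fin n} (hij : i ≠ j) : eqVec i j ≠ 0 := by
  intro h
  have := congrFun h j
  simp [eqVec, hij.symm] at this

theorem isFacet_setOf_eq (hn : 3 ≤ n) {i j : Fin n} (hij : (j : ℕ) = i + 1) :
    IsFacet (degreePartitionPolytope n) {x ∈ degreePartitionPolytope n | x i = x j} := by
  have hne : i ≠ j := by
    rintro rfl
    omega
  rw [setOf_eq_eq_eqVec_face]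
  refine isFacet_of_constOn (affineDim_degreePartitionPolytope hn) (eqVec_ne_zero hne)
    (fun x hx => ?_) ?_ fun w hw => ?_
  · have := antitone_of_mem hx (show i ≤ j by rw [Fin.le_def]; omega)
    rw [eqVec_dotProduct]
    linarith
  · refine ⟨degVec (relGraph fun _ b => b < 0),
      Shifted.degVec_mem fun a b a' b' _ _ _ _ _ => by omega, ?_⟩
    rw [eqVec_dotProduct, degVec_clique (by omega), degVec_clique (by omega)]
    simp
  · rw [← setOf_eq_eq_eqVec_face] at hw
    exact eq_smul_eqVec_of_constOn hn hij hw

end EqualCoordinates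

/-! ### Unlisted FHM inequalities and the classification -/

section Unlisted

variable {n k l : ℕ}

theorem fhmLhs_succ_left (hk : k < n) (x : Fin n → ℝ) :
    fhmLhs n (k + 1) l x = fhmLhs n k l x + x ⟨k, hk⟩ := by
  have : fhmVec n (k + 1) l = fhmVec n k l + Pi.single ⟨k, hk⟩ 1 := by
    ext i
    simp only [fhmVec, Pi.add_apply, Pi.single_apply, Fin.ext_iff]
    split_ifs <;> first | omega | norm_num
  rw [fhmLhs_eq_dotProduct, this, add_dotProduct, single_one_dotProduct, fhmLhs_eq_dotProduct]

theorem fhmLhs_succ_right (hl : l < n) (x : Fin n → ℝ) :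
    fhmLhs n k (l + 1) x = fhmLhs n k l x - x ⟨n - 1 - l, by omega⟩ := by
  have : fhmVec n k (l + 1) = fhmVec n k l - Pi.single ⟨n - 1 - l, by omega⟩ 1 := by
    ext i
    simp only [fhmVec, Pi.sub_apply, Pi.single_apply, Fin.ext_iff]
    split_ifs <;> first | omega | norm_num
  rw [fhmLhs_eq_dotProduct, this, sub_dotProduct, single_one_dotProduct, fhmLhs_eq_dotProduct]

theorem fhmLhs_zero_zero (x : Fin n → ℝ) : fhmLhs n 0 0 x = 0 := by
  have : fhmVec n 0 0 = 0 := by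
    ext i
    simp [fhmVec]
  rw [fhmLhs_eq_dotProduct, this, zero_dotProduct]

theorem facetPair_of_isFacet (hn : 4 ≤ n) (h0 : 1 ≤ k + l) (h : k + l ≤ n)
    (hF : IsFacet (degreePartitionPolytope n)
      {x ∈ degreePartitionPolytope n | fhmLhs n k l x = fhmRhs n k l}) :
    FacetPair n k l := by
  by_contra hnot
  set F := {x ∈ degreePartitionPolytope n | fhmLhs n k l x = fhmRhs n k l} with hFdef
  -- The coordinates `p` and `q` certify that `w` is nonzero and not a multiple of `fhmVec n k l`.
  obtain ⟨w, p, q, hp, hq, hwq, hw⟩ : ∃ (w : Fin n → ℝ) (p q : Fin n), w p ≠ 0 ∧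
      fhmVec n k l q ≠ 0 ∧ w q = 0 ∧ ConstOn w F := by
    rcases Nat.eq_zero_or_pos l with rfl | hl
    · obtain ⟨k, rfl⟩ : ∃ m, k = m + 1 := ⟨k - 1, by omega⟩
      have hk : 1 ≤ k := by unfold FacetPair at hnot; omega
      have hx : ∀ x ∈ F, x ⟨k, by omega⟩ = (n : ℝ) - 1 := by
        rintro x ⟨hx, hxF⟩
        have h1 := fhmLhs_le (k := k) (l := 0) (by omega) hx
        have h2 := fhmLhs_le (k := 1) (l := 0) (by omega) hx
        rw [fhmLhs_succ_left (by omega)] at hxF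
        rw [← zero_add 1, fhmLhs_succ_left (by omega), fhmLhs_zero_zero] at h2
        have h3 := antitone_of_mem hx (show (⟨0, by omega⟩ : Fin n) ≤ ⟨k, by omega⟩ by simp)
        simp only [fhmRhs] at h1 h2 hxF
        push_cast at h1 h2 hxF
        linarith
      refine ⟨Pi.single ⟨k, by omega⟩ 1, ⟨k, by omega⟩, ⟨0, by omega⟩, by simp, ?_, ?_,
        fun x hxF y hyF => ?_⟩
      · simp only [fhmVec]
        rw [if_pos (by omega), if_neg (by omega)]
        norm_num
      · rw [Pi.single_apply, if_neg (by rw [Fin.ext_iff]; simp only; omega)]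
      · simp [hx x hxF, hx y hyF]
    rcases Nat.eq_zero_or_pos k with rfl | hk
    · obtain ⟨l, rfl⟩ : ∃ m, l = m + 1 := ⟨l - 1, by omega⟩
      have hk : 1 ≤ l := by unfold FacetPair at hnot; omega
      have hx : ∀ x ∈ F, x ⟨n - 1 - l, by omega⟩ = 0 := by
        rintro x ⟨hx, hxF⟩
        have h1 := fhmLhs_le (k := 0) (l := l) (by omega) hx
        have h2 := fhmLhs_le (k := 0) (l := 1) (by omega) hx
        rw [fhmLhs_succ_right (by omega)] at hxF
        rw [← zero_add 1, fhmLhs_succ_right (by omega), fhmLhs_zero_zero] at h2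
        have h3 := antitone_of_mem hx (show (⟨n - 1 - l, by omega⟩ : Fin n) ≤
          ⟨n - 1 - 0, by omega⟩ by simp)
        simp only [fhmRhs] at h1 h2 hxF
        push_cast at h1 h2 hxF
        linarith
      refine ⟨Pi.single ⟨n - 1 - l, by omega⟩ 1, ⟨n - 1 - l, by omega⟩, ⟨n - 1, by omega⟩,
        by simp, ?_, ?_, fun x hxF y hyF => ?_⟩
      · simp only [fhmVec]
        rw [if_neg (by omega), if_pos (by omega)]
        norm_num
      · rw [Pi.single_apply, if_neg (by rw [Fin.ext_iff]; simp only; omega)]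
      · simp [hx x hxF, hx y hyF]
    have hq : fhmVec n k l ⟨0, by omega⟩ ≠ 0 := by
      simp only [fhmVec]
      rw [if_pos (by omega), if_neg (by omega)]
      norm_num
    have hcast : (n : ℝ) = k + l + 1 ∧ n = k + l + 1 ∨ (n : ℝ) = k + l + 2 ∧ n = k + l + 2 := by
      have : n = k + l + 1 ∨ n = k + l + 2 := by unfold FacetPair at hnot; omega
      rcases this with h1 | h1
      · exact Or.inl ⟨by exact_mod_cast h1, h1⟩
      · exact Or.inr ⟨by exact_mod_cast h1, h1⟩
    rcases hcast with ⟨hcast, hn'⟩ | ⟨hcast, hn'⟩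
    -- One middle coordinate remains; the inequalities for `(k + 1, l)` and `(k, l + 1)` bound it
    -- from above and below by `k`.
    · have hx : ∀ x ∈ F, x ⟨k, by omega⟩ = (k : ℝ) := by
        rintro x ⟨hx, hxF⟩
        have h1 := fhmLhs_le (k := k + 1) (l := l) (by omega) hx
        have h2 := fhmLhs_le (k := k) (l := l + 1) (by omega) hx
        rw [fhmLhs_succ_left (by omega), hxF] at h1
        rw [fhmLhs_succ_right (by omega), hxF] at h2
        have h3 : (⟨n - 1 - l, by omega⟩ : Fin n) = ⟨k, by omega⟩ := by
          rw [Fin.ext_iff]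
          simp only
          omega
        rw [h3] at h2
        simp only [fhmRhs, hcast] at h1 h2
        push_cast at h1 h2
        linarith
      refine ⟨Pi.single ⟨k, by omega⟩ 1, ⟨k, by omega⟩, ⟨0, by omega⟩, by simp, hq, ?_,
        fun x hxF y hyF => ?_⟩
      · rw [Pi.single_apply, if_neg (by rw [Fin.ext_iff]; simp only; omega)]
      · simp [hx x hxF, hx y hyF]
    -- Two middle coordinates remain. The bounds for `(k, l)` and `(k + 1, l + 1)` coincide, so
    -- tightness leaves no room for a gap between them.
    · have hx : ∀ x ∈ F, x ⟨k + 1, by omega⟩ = x ⟨k, by omega⟩ := by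
        rintro x ⟨hx, hxF⟩
        have h1 := fhmLhs_le (k := k + 1) (l := l + 1) (by omega) hx
        rw [fhmLhs_succ_left (by omega), fhmLhs_succ_right (by omega), hxF] at h1
        have h3 : (⟨n - 1 - l, by omega⟩ : Fin n) = ⟨k + 1, by omega⟩ := by
          rw [Fin.ext_iff]
          simp only
          omega
        have h4 := antitone_of_mem hx
          (show (⟨k, by omega⟩ : Fin n) ≤ ⟨k + 1, by omega⟩ by simp)
        rw [h3] at h1
        simp only [fhmRhs, hcast] at h1
        push_cast at h1
        linarith
      refine ⟨eqVec ⟨k, by omega⟩ ⟨k + 1, by omega⟩, ⟨k, by omega⟩, ⟨0, by omega⟩, ?_, hq, ?_,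
        fun x hxF y hyF => ?_⟩
      · simp [eqVec]
      · simp only [eqVec, Pi.sub_apply, Pi.single_apply, Fin.ext_iff]
        rw [if_neg (by omega), if_neg (by omega), sub_zero]
      · simp [eqVec_dotProduct, hx x hxF, hx y hyF]
  have hconst : ConstOn (fhmVec n k l) F := fun x hx y hy => by
    rw [← fhmLhs_eq_dotProduct, ← fhmLhs_eq_dotProduct, hx.2, hy.2]
  obtain ⟨r, rfl⟩ := hF.eq_smul_of_constOn (affineDim_degreePartitionPolytope (by omega))
    (fhmVec_ne_zero h0 h) hconst hw
  rw [Pi.smul_apply, smul_eq_mul, mul_eq_zero, or_iff_left hq] at hwq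
  simp [hwq] at hp

theorem isFacet_iff (hn : 4 ≤ n) (F : Set (Fin n → ℝ)) :
    IsFacet (degreePartitionPolytope n) F ↔
      ((∃ i j : Fin n, (j : ℕ) = i + 1 ∧ F = {x ∈ degreePartitionPolytope n | x i = x j}) ∨
        (∃ k l : ℕ, FacetPair n k l ∧
          F = {x ∈ degreePartitionPolytope n | fhmLhs n k l x = fhmRhs n k l})) := by
  have hP := affineDim_degreePartitionPolytope (n := n) (by omega)
  constructor
  · intro hF
    obtain ⟨c, hc0, hFc⟩ := hF.exists_functional
    by_cases hc : Antitone c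
    · obtain ⟨k, l, h0, h1, h2⟩ := exists_fhm_tight_of_antitone hc hc0
      have hFeq := hF.eq_of_subset hP (fhmVec_ne_zero h0 h1) (b := fhmRhs n k l) fun x hx => by
        rw [hFc] at hx
        exact h2 x hx.1 hx.2
      simp only [← fhmLhs_eq_dotProduct] at hFeq
      exact Or.inr ⟨k, l, facetPair_of_isFacet hn h0 h1 (hFeq ▸ hF), hFeq⟩
    · obtain ⟨i, j, hij, h⟩ := exists_eq_of_not_antitone hc
      have hne : i ≠ j := by
        rintro rfl
        omega
      refine Or.inl ⟨i, j, hij, ?_⟩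
      rw [setOf_eq_eq_eqVec_face]
      refine hF.eq_of_subset hP (eqVec_ne_zero hne) fun x hx => ?_
      rw [hFc] at hx
      rw [eqVec_dotProduct, h x hx.1 hx.2, sub_self]
  · rintro (⟨i, j, hij, rfl⟩ | ⟨k, l, hkl, rfl⟩)
    · exact isFacet_setOf_eq (by omega) hij
    · simp only [fhmLhs_eq_dotProduct]
      exact isFacet_fhmFace hP hn hkl

end Unlisted

/-! ### Distinctness and number of the facets -/

theorem eq_of_setOf_eq_eq {n : ℕ} (hn : 4 ≤ n) {i j i' j' : Fin n} (hij : (j : ℕ) = i + 1)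
    (hij' : (j' : ℕ) = i' + 1)
    (h : {x ∈ degreePartitionPolytope n | x i = x j}
      = {x ∈ degreePartitionPolytope n | x i' = x j'}) : i = i' := by
  have hP := affineDim_degreePartitionPolytope (n := n) (by omega)
  have hF := isFacet_setOf_eq (n := n) (by omega) hij
  have hne : i ≠ j := by
    rintro rfl
    omega
  have h1 : ConstOn (eqVec i j) {x ∈ degreePartitionPolytope n | x i = x j} := fun x hx y hy => by
    rw [eqVec_dotProduct, eqVec_dotProduct, hx.2, hy.2, sub_self, sub_self]
  have h2 : ConstOn (eqVec i' j') {x ∈ degreePartitionPolytope n | x i = x j} := by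
    rw [h]
    intro x hx y hy
    rw [eqVec_dotProduct, eqVec_dotProduct, hx.2, hy.2, sub_self, sub_self]
  obtain ⟨r, hr⟩ := hF.eq_smul_of_constOn hP (eqVec_ne_zero hne) h1 h2
  have h3 := congrFun hr i'
  have h4 := congrFun hr j'
  simp only [eqVec, Pi.smul_apply, Pi.sub_apply, Pi.single_apply, Fin.ext_iff, smul_eq_mul] at h3 h4
  rw [Fin.ext_iff]
  by_contra hii
  split_ifs at h3 h4 <;> first | omega | norm_num at h3 h4 | skip
  all_goals linarith

theorem setOf_eq_ne_fhmFace {n k l : ℕ} (hn : 4 ≤ n) {i j : Fin n} (hij : (j : ℕ) = i + 1)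
    (hkl : FacetPair n k l) :
    {x ∈ degreePartitionPolytope n | x i = x j}
      ≠ {x ∈ degreePartitionPolytope n | fhmLhs n k l x = fhmRhs n k l} := by
  intro h
  have hP := affineDim_degreePartitionPolytope (n := n) (by omega)
  have hF := isFacet_setOf_eq (n := n) (by omega) hij
  have hne : i ≠ j := by
    rintro rfl
    omega
  have h1 : ConstOn (eqVec i j) {x ∈ degreePartitionPolytope n | x i = x j} := fun x hx y hy => by
    rw [eqVec_dotProduct, eqVec_dotProduct, hx.2, hy.2, sub_self, sub_self]
  have h2 : ConstOn (fhmVec n k l) {x ∈ degreePartitionPolytope n | x i = x j} := by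
    rw [h]
    intro x hx y hy
    rw [← fhmLhs_eq_dotProduct, ← fhmLhs_eq_dotProduct, hx.2, hy.2]
  obtain ⟨r, hr⟩ := hF.eq_smul_of_constOn hP (eqVec_ne_zero hne) h1 h2
  have hle : k + l ≤ n := by unfold FacetPair at hkl; omega
  have hpos : 1 ≤ k + l := by unfold FacetPair at hkl; omega
  have hk01 : (k = 1 ∧ l = 0) ∨ (k = 0 ∧ l = 1) ∨ (1 ≤ k ∧ 1 ≤ l) := by
    unfold FacetPair at hkl
    omega
  have hval : ∀ u : Fin n, fhmVec n k l u = r * eqVec i j u := fun u => congrFun hr u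
  have hi : eqVec i j i = -1 := by simp [eqVec, hne]
  have hj : eqVec i j j = 1 := by simp [eqVec, hne.symm]
  have h0 : ∀ u : Fin n, u ≠ i → u ≠ j → eqVec i j u = 0 := fun u hi hj => by
    simp [eqVec, hi, hj]
  have hr0 : r ≠ 0 := by
    rintro rfl
    exact fhmVec_ne_zero hpos hle (by simpa using hr)
  have h3 := hval i
  have h4 := hval j
  rw [hi] at h3
  rw [hj] at h4
  have h5 : fhmVec n k l i = - fhmVec n k l j := by linarith
  rcases hk01 with ⟨rfl, rfl⟩ | ⟨rfl, rfl⟩ | ⟨hk, hl⟩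
  · simp only [fhmVec] at h4 h5
    rw [if_neg (show ¬ (j : ℕ) < 1 by omega), if_neg (show ¬ n ≤ (j : ℕ) + 0 by omega)] at h4
    exact hr0 (by linarith)
  · simp only [fhmVec] at h3 h5
    rw [if_neg (show ¬ (i : ℕ) < 0 by omega), if_neg (show ¬ n ≤ (i : ℕ) + 1 by omega)] at h3
    exact hr0 (by linarith)
  -- The support of `fhmVec` contains both ends `0` and `n - 1`, too far apart for the two adjacent
  -- indices `i` and `j`.
  · have hi0 : (i : ℕ) = 0 := by
      by_contra hi0
      have h6 := hval ⟨0, by omega⟩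
      rw [h0 _ (by rw [Ne, Fin.ext_iff]; simp only; omega)
        (by rw [Ne, Fin.ext_iff]; simp only; omega)] at h6
      simp only [fhmVec] at h6
      rw [if_pos (by omega), if_neg (by omega)] at h6
      norm_num at h6
    have h6 := hval ⟨n - 1, by omega⟩
    rw [h0 _ (by rw [Ne, Fin.ext_iff]; simp only; omega)
      (by rw [Ne, Fin.ext_iff]; simp only; omega)] at h6
    simp only [fhmVec] at h6
    rw [if_neg (by omega), if_pos (by omega)] at h6
    norm_num at h6

theorem fhmFace_injective {n k l k' l' : ℕ} (hn : 4 ≤ n) (hkl : FacetPair n k l)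
    (hkl' : FacetPair n k' l')
    (h : {x ∈ degreePartitionPolytope n | fhmLhs n k l x = fhmRhs n k l}
      = {x ∈ degreePartitionPolytope n | fhmLhs n k' l' x = fhmRhs n k' l'}) :
    k = k' ∧ l = l' := by
  have hP := affineDim_degreePartitionPolytope (n := n) (by omega)
  have hF : IsFacet (degreePartitionPolytope n)
      {x ∈ degreePartitionPolytope n | fhmLhs n k l x = fhmRhs n k l} :=
    (isFacet_iff hn _).2 (Or.inr ⟨k, l, hkl, rfl⟩)
  have h1 : ConstOn (fhmVec n k l)
      {x ∈ degreePartitionPolytope n | fhmLhs n k l x = fhmRhs n k l} := fun x hx y hy => by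
    rw [← fhmLhs_eq_dotProduct, ← fhmLhs_eq_dotProduct, hx.2, hy.2]
  have h2 : ConstOn (fhmVec n k' l')
      {x ∈ degreePartitionPolytope n | fhmLhs n k l x = fhmRhs n k l} := by
    rw [h]
    intro x hx y hy
    rw [← fhmLhs_eq_dotProduct, ← fhmLhs_eq_dotProduct, hx.2, hy.2]
  have hle : k + l ≤ n := by unfold FacetPair at hkl; omega
  have hpos : 1 ≤ k + l := by unfold FacetPair at hkl; omega
  have hle' : k' + l' ≤ n := by unfold FacetPair at hkl'; omega
  have hpos' : 1 ≤ k' + l' := by unfold FacetPair at hkl'; omega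
  have hkn : k < n ∧ l < n ∧ k' < n ∧ l' < n := by unfold FacetPair at hkl hkl'; omega
  obtain ⟨r, hr⟩ := hF.eq_smul_of_constOn hP (fhmVec_ne_zero hpos hle) h1 h2
  have hval : ∀ i : Fin n, fhmVec n k' l' i = r * fhmVec n k l i := fun i => congrFun hr i
  have hr1 : r = 1 := by
    have h3 := hval ⟨0, by omega⟩
    have h4 := hval ⟨n - 1, by omega⟩
    simp only [fhmVec] at h3 h4
    rw [if_neg (show ¬ n ≤ 0 + l by omega), if_neg (show ¬ n ≤ 0 + l' by omega)] at h3
    rw [if_neg (show ¬ n - 1 < k by omega), if_neg (show ¬ n - 1 < k' by omega)] at h4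
    split_ifs at h3 h4 <;> first | omega | linarith
  simp only [hr1, one_mul, fhmVec] at hval
  constructor
  · by_contra hne
    -- If `k ≠ k'`, this is the first index where exactly one of the two initial blocks is present.
    have h3 := hval ⟨min k k', by omega⟩
    split_ifs at h3 <;> simp only at * <;> first | omega | (exfalso; linarith)
  · by_contra hne
    have h3 := hval ⟨n - 1 - min l l', by omega⟩
    split_ifs at h3 <;> simp only at * <;> first | omega | (exfalso; linarith)

theorem ncard_facetPair {n : ℕ} (hn : 4 ≤ n) :
    ({p : ℕ × ℕ | FacetPair n p.1 p.2}.ncard : ℚ)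
      = 2 + ((n : ℚ) - 1) + ((n : ℚ) - 4) * ((n : ℚ) - 3) / 2 := by
  classical
  let X : Finset (ℕ × ℕ) := {(1, 0), (0, 1)}
  let Y : Finset (ℕ × ℕ) := (Finset.range (n - 1)).image fun i => (i + 1, n - 1 - i)
  -- The outer parameter is `k + l - 2` and the inner one is `k - 1`.
  let Z : Finset (ℕ × ℕ) := ((Finset.range (n - 4)).sigma fun i => Finset.range (i + 1)).image
    fun p => (p.2 + 1, p.1 - p.2 + 1)
  have hXYZ : {p : ℕ × ℕ | FacetPair n p.1 p.2} = ((X ∪ Y ∪ Z : Finset (ℕ × ℕ)) : Set (ℕ × ℕ)) := by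
    ext ⟨k, l⟩
    simp only [Set.mem_ofPred_eq, FacetPair, X, Y, Z, Finset.coe_union, Set.mem_union,
      Finset.mem_coe, Finset.mem_insert, Finset.mem_singleton, Finset.mem_image, Finset.mem_sigma,
      Finset.mem_range, Prod.mk.injEq, Sigma.exists]
    constructor
    · rintro (h | h | ⟨hk, hl, h | h⟩)
      · exact Or.inl (Or.inl (Or.inl h))
      · exact Or.inl (Or.inl (Or.inr h))
      · exact Or.inr ⟨k + l - 2, k - 1, by omega, by omega, by omega⟩
      · exact Or.inl (Or.inr ⟨k - 1, by omega, by omega, by omega⟩)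
    · rintro (((h | h) | ⟨i, hi, h1, h2⟩) | ⟨i, j, hij, h1, h2⟩) <;> omega
  have hY : Y.card = n - 1 := by
    rw [Finset.card_image_of_injective, Finset.card_range]
    intro i j hij
    simpa using congrArg Prod.fst hij
  have hZ : Z.card = ∑ i ∈ Finset.range (n - 4), (i + 1) := by
    rw [Finset.card_image_of_injOn, Finset.card_sigma]
    · simp
    · rintro ⟨i, j⟩ hij ⟨i', j'⟩ hij' h
      simp only [Finset.coe_sigma, Set.mem_sigma_iff, Finset.mem_coe, Finset.mem_range,
        Prod.mk.injEq] at hij hij' h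
      obtain rfl : j = j' := by omega
      obtain rfl : i = i' := by omega
      rfl
  have hXY : Disjoint X Y := by
    rw [Finset.disjoint_left]
    rintro ⟨k, l⟩ h1 h2
    simp only [X, Y, Finset.mem_insert, Finset.mem_singleton, Finset.mem_image, Finset.mem_range,
      Prod.mk.injEq] at h1 h2
    obtain ⟨i, h2⟩ := h2
    omega
  have hXYZd : Disjoint (X ∪ Y) Z := by
    rw [Finset.disjoint_left]
    rintro ⟨k, l⟩ h1 h2
    simp only [X, Y, Z, Finset.mem_union, Finset.mem_insert, Finset.mem_singleton,
      Finset.mem_image, Finset.mem_range, Finset.mem_sigma, Prod.mk.injEq, Sigma.exists] at h1 h2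
    obtain ⟨i, j, h2⟩ := h2
    rcases h1 with h1 | ⟨i', h1⟩ <;> omega
  have hsum : ∀ m : ℕ, ((∑ i ∈ Finset.range m, (i + 1) : ℕ) : ℚ) = (m : ℚ) * (m + 1) / 2 := by
    intro m
    induction m with
    | zero => simp
    | succ m ih =>
      rw [Finset.sum_range_succ, Nat.cast_add, ih]
      push_cast
      ring
  rw [hXYZ, Set.ncard_coe_finset, Finset.card_union_of_disjoint hXYZd,
    Finset.card_union_of_disjoint hXY, hY, hZ, Nat.cast_add, Nat.cast_add, hsum,
    Nat.cast_sub (by omega), Nat.cast_sub hn]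
  have hX : X.card = 2 := rfl
  rw [hX]
  push_cast
  ring

theorem ncard_facets {n : ℕ} (hn : 4 ≤ n) :
    ({F : Set (Fin n → ℝ) | IsFacet (degreePartitionPolytope n) F}.ncard : ℚ) =
      (n : ℚ) * ((n : ℚ) - 3) / 2 + 6 := by
  let f : Fin (n - 1) → Set (Fin n → ℝ) := fun i =>
    {x ∈ degreePartitionPolytope n | x ⟨i, by omega⟩ = x ⟨i + 1, by omega⟩}
  let g : ℕ × ℕ → Set (Fin n → ℝ) := fun p =>
    {x ∈ degreePartitionPolytope n | fhmLhs n p.1 p.2 x = fhmRhs n p.1 p.2}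
  let S : Set (ℕ × ℕ) := {p | FacetPair n p.1 p.2}
  have hf : Function.Injective f := fun i i' h => by
    have := eq_of_setOf_eq_eq hn rfl rfl h
    simpa [Fin.ext_iff] using this
  have hg : Set.InjOn g S := fun p hp p' hp' h => by
    obtain ⟨h1, h2⟩ := fhmFace_injective hn hp hp' h
    exact Prod.ext h1 h2
  have hSfin : S.Finite := by
    refine ((Finset.range (n + 1)) ×ˢ (Finset.range (n + 1))).finite_toSet.subset ?_
    rintro ⟨k, l⟩ hp
    simp only [S, Set.mem_ofPred_eq, FacetPair] at hp
    simp only [Finset.coe_product, Finset.coe_range, Set.mem_prod, Set.mem_Iio]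
    omega
  have hset : {F : Set (Fin n → ℝ) | IsFacet (degreePartitionPolytope n) F}
      = Set.range f ∪ g '' S := by
    ext F
    rw [Set.mem_ofPred_eq, isFacet_iff hn]
    constructor
    · rintro (⟨i, j, hij, rfl⟩ | ⟨k, l, hkl, rfl⟩)
      · refine Or.inl ⟨⟨i, by omega⟩, ?_⟩
        have hj : j = ⟨i + 1, by omega⟩ := Fin.ext hij
        simp only [f, hj]
      · exact Or.inr ⟨(k, l), hkl, rfl⟩
    · rintro (⟨i, rfl⟩ | ⟨⟨k, l⟩, hkl, rfl⟩)
      · exact Or.inl ⟨_, _, rfl, rfl⟩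
      · exact Or.inr ⟨k, l, hkl, rfl⟩
  have hdisj : Disjoint (Set.range f) (g '' S) := by
    rw [Set.disjoint_left]
    rintro _ ⟨i, rfl⟩ ⟨⟨k, l⟩, hkl, h⟩
    exact setOf_eq_ne_fhmFace hn rfl hkl h.symm
  rw [hset, Set.ncard_union_eq hdisj (Set.finite_range f) (hSfin.image g), ← Set.image_univ,
    Set.ncard_image_of_injective _ hf, hg.ncard_image, Set.ncard_univ, Nat.card_fin,
    Nat.cast_add, ncard_facetPair hn, Nat.cast_sub (by omega)]
  push_cast
  ring

theorem mainTheorem3 (n : ℕ) (hn : 4 ≤ n) :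
    -- the inequalities are valid on the polytope
    (∀ x ∈ degreePartitionPolytope n, ∀ i j : Fin n, (j : ℕ) = i + 1 → x i ≥ x j) ∧
    (∀ x ∈ degreePartitionPolytope n, ∀ k l : ℕ, 1 ≤ k + l → k + l ≤ n →
      fhmLhs n k l x ≤ fhmRhs n k l) ∧
    -- the facets are exactly the faces cut out by the listed inequalities
    (∀ F : Set (Fin n → ℝ), IsFacet (degreePartitionPolytope n) F ↔
      ((∃ i j : Fin n, (j : ℕ) = i + 1 ∧ F = {x ∈ degreePartitionPolytope n | x i = x j}) ∨
        (∃ k l : ℕ, FacetPair n k l ∧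
          F = {x ∈ degreePartitionPolytope n | fhmLhs n k l x = fhmRhs n k l}))) ∧
    -- among all the FHM inequalities, exactly the listed ones determine facets
    (∀ k l : ℕ, 1 ≤ k + l → k + l ≤ n →
      (IsFacet (degreePartitionPolytope n)
          {x ∈ degreePartitionPolytope n | fhmLhs n k l x = fhmRhs n k l} ↔
        FacetPair n k l)) ∧
    -- the number of facets
    ({F : Set (Fin n → ℝ) | IsFacet (degreePartitionPolytope n) F}.ncard : ℚ) =
      (n : ℚ) * ((n : ℚ) - 3) / 2 + 6 := by
  refine ⟨fun x hx i j hij => antitone_of_mem hx ?_, fun x hx k l _ h => fhmLhs_le h hx,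
    isFacet_iff hn, fun k l h0 h => ⟨facetPair_of_isFacet hn h0 h, fun hkl => ?_⟩, ncard_facets hn⟩
  · rw [Fin.le_def]
    omega
  · exact (isFacet_iff hn _).2 (Or.inr ⟨k, l, hkl, rfl⟩)
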